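/- Let $X$ be a real Banach space with dual $X^*$ and let $Z\subseteq Y\subseteq X$ be closed linear subspaces. A closed subspace $W$ of a Banach space $V$ has property-$(wU)$ in $V$ if every $w^*\in W^*$ satisfying $\|w^*\|=w^*(w_0)$ for some $w_0\in W$ with $\|w_0\|=1$ has a unique norm-preserving extension to $V$. A closed subspace $J$ of $X$ is a semi-$M$-ideal in $X$ if, with $J^\perp=\{x^*\in X^*: x^*|_J=0\}$, there is a closed set $S\subseteq X^*$ (not necessarily a linear subspace) with $X^*=J^\perp\oplus_{\ell_1}S$, i.e. every $x^*\in X^*$ can be written in exactly one way as $x^*=a+b$ with $a\in J^\perp$, $b\in S$, and $\|a+b\|=\|a\|+\|b\|$ for all $a\in J^\perp$, $b\in S$. If $Z$ is a semi-$M$-ideal in $X$ and $Y/Z$ has property-$(wU)$ in $X/Z$, then $Y$ has property-$(wU)$ in $X$. -/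

import Mathlib

/-- The annihilator `Y^⊥ = {x* ∈ X* : x*|_Y = 0}` in the continuous dual of `X`. -/
def dualAnn {X : Type*} [NormedAddCommGroup X] [NormedSpace ℝ X] (Y : Submodule ℝ X) :
    Set (StrongDual ℝ X) :=
  {g | ∀ y ∈ Y, g y = 0}

/-- `HB(f)`: the norm-preserving (Hahn-Banach) extensions to `X` of a functional `f ∈ Y*`. -/
def hahnBanachExt {X : Type*} [NormedAddCommGroup X] [NormedSpace ℝ X] (Y : Submodule ℝ X)
    (f : StrongDual ℝ Y) : Set (StrongDual ℝ X) :=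
  {g | ‖g‖ = ‖f‖ ∧ ∀ y : Y, g y = f y}

/-- Property-(wU) of `Y` in `X`: every functional `f ∈ Y*` that attains its norm at some point of
the unit sphere of `Y` has a unique norm-preserving extension to `X`. -/
def PropertyWU {X : Type*} [NormedAddCommGroup X] [NormedSpace ℝ X] (Y : Submodule ℝ X) : Prop :=
  ∀ f : StrongDual ℝ Y, (∃ y₀ : Y, ‖y₀‖ = 1 ∧ ‖f‖ = f y₀) → ∃! g, g ∈ hahnBanachExt Y f

/-- `J` is a semi-M-ideal in `X`: `X* = J^⊥ ⊕_{ℓ₁} S` for some (norm) closed set `S ⊆ X*`, which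
need not be a linear subspace. That is, every `x* ∈ X*` has exactly one decomposition
`x* = p.1 + p.2` with `p.1 ∈ J^⊥`, `p.2 ∈ S`, and the norm is additive on these sums. -/
def IsSemiMIdeal {X : Type*} [NormedAddCommGroup X] [NormedSpace ℝ X] (J : Submodule ℝ X) : Prop :=
  ∃ S : Set (StrongDual ℝ X), IsClosed S ∧
    (∀ g : StrongDual ℝ X, ∃! p : StrongDual ℝ X × StrongDual ℝ X,
      p.1 ∈ dualAnn J ∧ p.2 ∈ S ∧ g = p.1 + p.2) ∧
    (∀ a ∈ dualAnn J, ∀ b ∈ S, ‖a + b‖ = ‖a‖ + ‖b‖)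

/-!
Uniqueness is the point; existence is the Hahn–Banach theorem. Let `f ∈ Y*` attain its norm at
`y₀`, let `g₁, g₂` be norm-preserving extensions of `f` to `X`, and write `gᵢ = aᵢ + bᵢ` with
`aᵢ ∈ Z^⊥`, `bᵢ ∈ S` according to the semi-`M`-ideal decomposition.

* As `g₁ = g₂` on `Z`, the difference `b₁ - b₂` lies in `Z^⊥`, so `b₁ = 0 + b₁ = (b₁ - b₂) + b₂`
  are two decompositions of `b₁` and hence `b₁ = b₂`
  (`IsSemiMIdeal.exists_common_decomposition`).
* Since `‖gᵢ‖ = ‖aᵢ‖ + ‖bᵢ‖` and `gᵢ` attains its norm at `y₀`, both summands attain their norms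
  at `y₀`.
* The functionals induced by `a₁, a₂` on `X ⧸ Z` agree on `Y / Z` and attain their norms at the
  class of `y₀`, so property-`(wU)` of `Y / Z` identifies them
  (`PropertyWU.eq_of_norm_le_apply`).
-/

/-- If `W` has property-(wU), two functionals on the whole space which agree on `W` and attain
their norms at a common point of the unit ball of `W` are equal. The point need not be a unit
vector: if it is not, both functionals vanish. -/
theorem PropertyWU.eq_of_norm_le_apply {V : Type*} [NormedAddCommGroup V] [NormedSpace ℝ V]
    {W : Submodule ℝ V} (hW : PropertyWU W) {g₁ g₂ : StrongDual ℝ V}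
    (hg : ∀ w ∈ W, g₁ w = g₂ w) {w₀ : V} (hw₀ : w₀ ∈ W) (hw₀_norm : ‖w₀‖ ≤ 1)
    (h₁ : ‖g₁‖ ≤ g₁ w₀) (h₂ : ‖g₂‖ ≤ g₂ w₀) : g₁ = g₂ := by
  have hle : ∀ g : StrongDual ℝ V, g w₀ ≤ ‖g‖ := fun g =>
    (le_abs_self _).trans (g.unit_le_opNorm w₀ hw₀_norm)
  have hnorm : ‖g₂‖ = ‖g₁‖ := by
    rw [h₁.antisymm (hle g₁), h₂.antisymm (hle g₂), hg w₀ hw₀]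
  rcases (norm_nonneg g₁).eq_or_lt with h0 | hpos
  · rw [norm_eq_zero.mp h0.symm, norm_eq_zero.mp (hnorm.trans h0.symm)]
  have hw₀_one : ‖w₀‖ = 1 := by
    refine le_antisymm hw₀_norm (le_of_mul_le_mul_left ?_ hpos)
    calc ‖g₁‖ * 1 ≤ g₁ w₀ := by rwa [mul_one]
      _ ≤ ‖g₁‖ * ‖w₀‖ := (le_abs_self _).trans (g₁.le_opNorm w₀)
  let f : StrongDual ℝ W := g₁.comp W.subtypeL
  have hf_le : ‖f‖ ≤ ‖g₁‖ := f.opNorm_le_bound (norm_nonneg _) fun w => g₁.le_opNorm w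
  have hf_ge : g₁ w₀ ≤ ‖f‖ :=
    (le_abs_self _).trans (f.unit_le_opNorm ⟨w₀, hw₀⟩ hw₀_norm)
  have hf : ‖g₁‖ = ‖f‖ := le_antisymm (h₁.trans hf_ge) hf_le
  exact (hW f ⟨⟨w₀, hw₀⟩, hw₀_one, le_antisymm (hf_le.trans h₁) hf_ge⟩).unique
    ⟨hf, fun _ => rfl⟩ ⟨hnorm.trans hf, fun w => (hg w w.2).symm⟩

/-- A functional in `Z^⊥` factors through `X ⧸ Z` without increase of the norm. -/
theorem exists_quotient_functional {X : Type*} [NormedAddCommGroup X] [NormedSpace ℝ X]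
    {Z : Submodule ℝ X} [IsClosed (Z : Set X)] {a : StrongDual ℝ X} (ha : a ∈ dualAnn Z) :
    ∃ h : StrongDual ℝ (X ⧸ Z), ‖h‖ ≤ ‖a‖ ∧ ∀ x, h (Z.mkQ x) = a x := by
  have hbound : ∀ q : X ⧸ Z, ‖Z.liftQ a.toLinearMap ha q‖ ≤ ‖a‖ * ‖q‖ := by
    intro q
    obtain ⟨x, rfl⟩ := Z.mkQ_surjective q
    let φ : NormedAddGroupHom X ℝ :=
      a.toLinearMap.toAddMonoidHom.mkNormedAddGroupHom ‖a‖ a.le_opNorm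
    have hφ : ‖φ‖ ≤ ‖a‖ :=
      AddMonoidHom.mkNormedAddGroupHom_norm_le _ (norm_nonneg a) a.le_opNorm
    exact (QuotientAddGroup.norm_lift_apply_le (S := Z.toAddSubgroup) φ ha (x : X ⧸ _)).trans
      (mul_le_mul_of_nonneg_right hφ (norm_nonneg _))
  exact ⟨LinearMap.mkContinuous _ ‖a‖ hbound,
    LinearMap.mkContinuous_norm_le _ (norm_nonneg a) hbound, fun _ => rfl⟩

/-- Functionals which agree on a semi-`M`-ideal `J` differ only in their components in `J^⊥`. -/
theorem IsSemiMIdeal.exists_common_decomposition {X : Type*} [NormedAddCommGroup X]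
    [NormedSpace ℝ X] {J : Submodule ℝ X} (hJ : IsSemiMIdeal J) {g₁ g₂ : StrongDual ℝ X}
    (hg : ∀ z ∈ J, g₁ z = g₂ z) :
    ∃ a₁ ∈ dualAnn J, ∃ a₂ ∈ dualAnn J, ∃ b : StrongDual ℝ X, g₁ = a₁ + b ∧ g₂ = a₂ + b ∧
      ‖g₁‖ = ‖a₁‖ + ‖b‖ ∧ ‖g₂‖ = ‖a₂‖ + ‖b‖ := by
  obtain ⟨S, -, hdec, hnorm⟩ := hJ
  obtain ⟨⟨a₁, b₁⟩, ⟨ha₁, hb₁, rfl⟩, -⟩ := hdec g₁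
  obtain ⟨⟨a₂, b₂⟩, ⟨ha₂, hb₂, rfl⟩, -⟩ := hdec g₂
  dsimp only at *
  have hdiff : b₁ - b₂ ∈ dualAnn J := fun z hz => by
    have h := hg z hz
    simp only [add_apply, ha₁ z hz, ha₂ z hz, zero_add] at h
    simp [h]
  have hb : b₁ = b₂ := congrArg Prod.snd <| (hdec b₁).unique
    (y₁ := (0, b₁)) (y₂ := (b₁ - b₂, b₂))
    ⟨fun _ _ => rfl, hb₁, (zero_add b₁).symm⟩ ⟨hdiff, hb₂, (sub_add_cancel b₁ b₂).symm⟩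
  subst hb
  exact ⟨a₁, ha₁, a₂, ha₂, b₁, rfl, rfl, hnorm a₁ ha₁ b₁ hb₁, hnorm a₂ ha₂ b₁ hb₂⟩

theorem theorem2p2 {X : Type*} [NormedAddCommGroup X] [NormedSpace ℝ X] [CompleteSpace X]
    (Y Z : Submodule ℝ X) [IsClosed (Y : Set X)] [IsClosed (Z : Set X)] (hZY : Z ≤ Y)
    (hZ : IsSemiMIdeal Z)
    (hYZ : PropertyWU (X := X ⧸ Z) (Y.map Z.mkQ)) :
    PropertyWU Y := by
  rintro f ⟨y₀, hy₀, hf⟩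
  refine existsUnique_of_exists_of_unique ?_ ?_
  · obtain ⟨g, hg, hgn⟩ := exists_extension_norm_eq Y f
    exact ⟨g, hgn, hg⟩
  rintro g₁ g₂ ⟨hn₁, he₁⟩ ⟨hn₂, he₂⟩
  have hY : ∀ y ∈ Y, g₁ y = g₂ y := fun y hy => (he₁ ⟨y, hy⟩).trans (he₂ ⟨y, hy⟩).symm
  obtain ⟨a₁, ha₁, a₂, ha₂, b, rfl, rfl, hab₁, hab₂⟩ :=
    hZ.exists_common_decomposition fun z hz => hY z (hZY hz)
  have hy₀_norm : ‖(y₀ : X)‖ ≤ 1 := hy₀.le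
  have hb : b y₀ ≤ ‖b‖ := (le_abs_self _).trans (b.unit_le_opNorm _ hy₀_norm)
  have he₁₀ := he₁ y₀
  have he₂₀ := he₂ y₀
  rw [add_apply] at he₁₀ he₂₀
  -- The norm of `aᵢ + b` is additive, so attainment at `y₀` passes to `aᵢ`.
  have hatt₁ : ‖a₁‖ ≤ a₁ y₀ := by linarith
  have hatt₂ : ‖a₂‖ ≤ a₂ y₀ := by linarith
  obtain ⟨h₁, hh₁, hq₁⟩ := exists_quotient_functional ha₁
  obtain ⟨h₂, hh₂, hq₂⟩ := exists_quotient_functional ha₂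
  have hh : h₁ = h₂ := by
    refine hYZ.eq_of_norm_le_apply ?_ (Submodule.mem_map_of_mem y₀.2)
      ((Submodule.Quotient.norm_mk_le Z (y₀ : X)).trans hy₀_norm) ?_ ?_
    · rintro _ ⟨y, hy, rfl⟩
      rw [hq₁, hq₂]
      exact add_right_cancel (hY y hy)
    · exact (hq₁ y₀).symm ▸ hh₁.trans hatt₁
    · exact (hq₂ y₀).symm ▸ hh₂.trans hatt₂
  have ha : a₁ = a₂ := by
    ext x
    rw [← hq₁, ← hq₂, hh]
  rw [ha]
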